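/- For a finite simple graph $G$ on $n\ge 1$ vertices and $1\le k\le n$, the $k$-token graph $F_k(G)$ is the graph whose vertices are the $k$-element subsets of $V(G)$, two of them $A$ and $B$ being adjacent when $A\triangle B=\{a,b\}$ with $a\in A$, $b\in B$ and $\{a,b\}\in E(G)$. For a finite graph $H$ on at least two vertices, with Laplacian matrix $L(H)=D(H)-A(H)$ (the diagonal matrix of vertex degrees minus the adjacency matrix), the algebraic connectivity $\alpha(H)$ is the smallest eigenvalue of $L(H)$ on the space of vectors orthogonal to the all-ones vector; equivalently, it is the second smallest eigenvalue of $L(H)$ counted with multiplicity. Theorem. For each of the following classes of graphs, the algebraic connectivity of $F_k(G)$ equals that of $G$: (i) If $G=K_n$ is the complete graph on $n$ vertices, then $\alpha(F_k(G))=\alpha(G)=n$ for every $n$ and every $k=1,\dots,n-1$. (ii) If $G=S_n=K_{1,n-1}$ is the star graph on $n$ vertices, then $\alpha(F_k(G))=\alpha(G)$ for every $n$ and every $k=1,\dots,n-1$, and this common value is $1$ unless $n=2$. (iii) If $G=P_n$ is the path graph on $n$ vertices, then $\alpha(F_k(G))=\alpha(G)=2\bigl(1-\cos(\pi/n)\bigr)$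 for every $n$ and every $k=1,\dots,n-1$. (iv) If $G=K_{n_1,n_2}$ is the complete bipartite graph on $n=n_1+n_2$ vertices with $n_1\le n_2$, then $\alpha(F_k(G))=\alpha(G)$ for every such $n_1,n_2$ and every $k=1,\dots,n-1$, and this common value is $n_1$ unless $n_1=n_2=1$. -/

import Mathlib

/-- The `k`-token graph `F_k(G)`: its vertices are the `k`-subsets of vertices of `G`, and `A`, `B`
are adjacent when `A ∆ B` is a pair `{a, b}` with `a ∈ A`, `b ∈ B` and `a`, `b` adjacent in `G`. -/
def tokenGraph {V : Type*} [DecidableEq V] (G : SimpleGraph V) (k : ℕ) :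
    SimpleGraph {A : Finset V // A.card = k} where
  Adj A B := ∃ a ∈ A.1, ∃ b ∈ B.1, symmDiff A.1 B.1 = {a, b} ∧ G.Adj a b
  symm := ⟨by
    rintro A B ⟨a, ha, b, hb, h, hab⟩
    exact ⟨b, hb, a, ha, by rw [symmDiff_comm, h, Finset.pair_comm], hab.symm⟩⟩
  loopless := ⟨by
    rintro A ⟨a, _, b, _, h, _⟩
    have : a ∈ symmDiff A.1 A.1 := by rw [h]; simp
    simp at this⟩

open Classical in
/-- The eigenvalues (as real numbers) of the Laplacian matrix `L(G) = D(G) - A(G)` restricted to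
the space `W` of vectors orthogonal to the all-`1` vector. -/
def lapEigenvaluesOnW {V : Type*} [Fintype V] (G : SimpleGraph V) : Set ℝ :=
  {μ : ℝ | ∃ v : V → ℝ, v ≠ 0 ∧ ∑ x, v x = 0 ∧ (G.lapMatrix ℝ).mulVec v = μ • v}

/-- The algebraic connectivity `α(G)` of a finite graph on at least two vertices: the smallest
eigenvalue of the Laplacian matrix on the orthogonal complement `W` of the all-`1` vector. As
`L(G)` is symmetric positive semidefinite and kills the all-`1` vector, this is the second smallest
Laplacian eigenvalue counted with multiplicity. (For at least two vertices the set below is finite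
and nonempty, so that the infimum is its minimum.) -/
noncomputable def algebraicConnectivity {V : Type*} [Fintype V] (G : SimpleGraph V) : ℝ :=
  sInf (lapEigenvaluesOnW G)

/-!
The lower bounds for the spectral gap are proved for the quadratic forms, simultaneously for all
numbers `k` of tokens and by induction on the vertex set `S`.

A function `f` on the `k`-subsets of `S` with sum zero splits as the lift `A ↦ ∑ x ∈ A, v x` of a
zero-sum function `v` on `S`, plus a function `g` which sums to zero over the configurations
occupying any given vertex. The square norm and the Dirichlet form are additive in this
decomposition, and on lifts the form is that of the graph itself, so that the gap of the graph
handles the first part (`HasGap.hasTokenGap`). For the second part, delete a vertex `x`: on the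
configurations occupying `x`, and on those avoiding `x`, the function `g` still has sum zero, so
that the gap of the token process on `S \ {x}` bounds the norm of `g` by the energy of the edges
avoiding `x` (`HasTokenGap.le_sum_erase`). Averaging over several `x` gains a factor, because every
edge is lost in some of the deletions (`HasGap.hasTokenGap_of_erase`).

* For a complete graph on `N ≥ 3` vertices, an edge survives `N - 2` of the `N` deletions, and the
  bound `N (N - 1) / (N - 2)` exceeds `N`.
* For a complete bipartite graph, the vertices of a largest class are deleted. If that class is
  strictly larger, the gap does not drop; if both classes have `m ≥ 2` vertices, the gap drops from
  `m` to `m - 1`, but an edge survives only `m - 1` of the `m` deletions. Stars are the case of a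
  class with a single vertex.
* For a path, deleting an end vertex leaves a shorter path, whose gap is larger.

The gap of the graph itself is immediate for complete and complete bipartite graphs, and is the
discrete Wirtinger inequality `wirtinger_sum_le` for paths. Conversely, eigenvectors of the graph
lift to the token graph (`mem_lapEigenvaluesOnW_tokenGraph`), so that the bounds are attained. The
single edge `K₂`, whose connectivity is `2`, is treated as a complete graph whenever it arises as a
star or as a complete bipartite graph.
-/

/-! ### Functions on token configurations -/

/-- The image of the vertex set `A` under the transposition of `a` and `b`. -/
def swapSet {V : Type*} [DecidableEq V] (a b : V) (A : Finset V) : Finset V :=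
  A.map (Equiv.swap a b).toEmbedding

/-- The function `A ↦ ∑ x ∈ A, v x` on token configurations induced by a function `v` on vertices. -/
def tokenLift {V : Type*} (v : V → ℝ) (A : Finset V) : ℝ := ∑ x ∈ A, v x

/-- The Dirichlet form of the `k`-token process on the vertex set `S` with edge weights `w`. All
configurations `A` and all ordered pairs `(a, b)` contribute, so that a move along an edge is
counted four times and the value is `4 * ⟨f, L f⟩` for the Laplacian `L` of the token graph. -/
def tokenEnergy {V : Type*} [DecidableEq V] (w : V → V → ℝ) (S : Finset V) (k : ℕ)
    (f : Finset V → ℝ) : ℝ :=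
  ∑ a ∈ S, ∑ b ∈ S, w a b * ∑ A ∈ S.powersetCard k, (f (swapSet a b A) - f A) ^ 2

/-- The weighted graph `w` on `S` has spectral gap at least `l`. The factor `2` matches the sum over
ordered pairs. -/
def HasGap {V : Type*} (w : V → V → ℝ) (S : Finset V) (l : ℝ) : Prop :=
  ∀ v : V → ℝ, ∑ x ∈ S, v x = 0 →
    2 * l * ∑ x ∈ S, v x ^ 2 ≤ ∑ a ∈ S, ∑ b ∈ S, w a b * (v a - v b) ^ 2

/-- For every number `k` of tokens, the `k`-token process on `S` with weights `w` has spectral gap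
at least `l`. The factor `4` is the one in `tokenEnergy`. -/
def HasTokenGap {V : Type*} [DecidableEq V] (w : V → V → ℝ) (S : Finset V) (l : ℝ) : Prop :=
  ∀ (k : ℕ) (f : Finset V → ℝ), ∑ A ∈ S.powersetCard k, f A = 0 →
    4 * l * ∑ A ∈ S.powersetCard k, f A ^ 2 ≤ tokenEnergy w S k f

section
variable {V : Type*} [DecidableEq V]

lemma mem_swapSet {a b x : V} {A : Finset V} : x ∈ swapSet a b A ↔ Equiv.swap a b x ∈ A := by
  simp [swapSet, Finset.mem_map_equiv]

lemma card_swapSet (a b : V) (A : Finset V) : (swapSet a b A).card = A.card := by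
  simp [swapSet]

lemma swapSet_swapSet (a b : V) (A : Finset V) : swapSet a b (swapSet a b A) = A := by
  ext x; simp [mem_swapSet]

lemma swapSet_comm (a b : V) (A : Finset V) : swapSet a b A = swapSet b a A := by
  rw [swapSet, Equiv.swap_comm]; rfl

lemma swapSet_self (a : V) (A : Finset V) : swapSet a a A = A := by
  ext x; simp [mem_swapSet]

lemma swapSet_insert {a b x : V} (hxa : x ≠ a) (hxb : x ≠ b) (A : Finset V) :
    swapSet a b (insert x A) = insert x (swapSet a b A) := by
  simp [swapSet, Finset.map_insert, Equiv.swap_apply_of_ne_of_ne hxa hxb]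

lemma swapSet_eq_self {a b : V} {A : Finset V} (h : a ∈ A ↔ b ∈ A) : swapSet a b A = A := by
  ext x
  rw [mem_swapSet, Equiv.swap_apply_def]
  grind

lemma swapSet_subset {a b : V} {A S : Finset V} (ha : a ∈ S) (hb : b ∈ S) (h : A ⊆ S) :
    swapSet a b A ⊆ S := by
  intro x hx
  rw [mem_swapSet, Equiv.swap_apply_def] at hx
  grind

lemma sum_swapSet {S : Finset V} {a b : V} (ha : a ∈ S) (hb : b ∈ S) (k : ℕ)
    (F : Finset V → ℝ) :
    ∑ A ∈ S.powersetCard k, F (swapSet a b A) = ∑ A ∈ S.powersetCard k, F A := by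
  refine Finset.sum_nbij' (swapSet a b) (swapSet a b) ?_ ?_ ?_ ?_ ?_
  · intro A hA
    rw [Finset.mem_powersetCard] at hA ⊢
    exact ⟨swapSet_subset ha hb hA.1, (card_swapSet a b A).trans hA.2⟩
  · intro A hA
    rw [Finset.mem_powersetCard] at hA ⊢
    exact ⟨swapSet_subset ha hb hA.1, (card_swapSet a b A).trans hA.2⟩
  · intro A _; exact swapSet_swapSet a b A
  · intro A _; exact swapSet_swapSet a b A
  · intro A _; rfl

lemma sum_powersetCard_sum (S : Finset V) (k : ℕ) (F : V → Finset V → ℝ) :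
    ∑ A ∈ S.powersetCard k, ∑ x ∈ A, F x A
      = ∑ x ∈ S, ∑ A ∈ S.powersetCard k, if x ∈ A then F x A else 0 := by
  rw [Finset.sum_comm]
  refine Finset.sum_congr rfl fun A hA => ?_
  rw [← Finset.sum_filter, Finset.filter_mem_eq_inter,
    Finset.inter_eq_right.mpr (Finset.mem_powersetCard.mp hA).1]

lemma sum_sum_mem (S : Finset V) (k : ℕ) (f : Finset V → ℝ) :
    ∑ x ∈ S, ∑ A ∈ S.powersetCard k, (if x ∈ A then f A else 0)
      = k * ∑ A ∈ S.powersetCard k, f A := by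
  rw [← sum_powersetCard_sum S k fun _ A => f A, Finset.mul_sum]
  refine Finset.sum_congr rfl fun A hA => ?_
  rw [Finset.sum_const, (Finset.mem_powersetCard.mp hA).2, nsmul_eq_mul]

/-- Exactly `(|S| - 2).choose (k - 1)` of the `k`-subsets of `S` separate `x` from `y`. -/
lemma sum_mem_notMem {S : Finset V} {x y : V} (hx : x ∈ S) (hy : y ∈ S) (hxy : x ≠ y) {k : ℕ}
    (hk : 1 ≤ k) :
    ∑ A ∈ S.powersetCard k, (if x ∈ A ∧ y ∉ A then (1 : ℝ) else 0)
      = ((S.card - 2).choose (k - 1) : ℕ) := by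
  have h : (S.powersetCard k).filter (fun A => x ∈ A ∧ y ∉ A)
      = (((S.erase x).erase y).powersetCard (k - 1)).image (insert x) := by
    ext A
    simp only [Finset.mem_filter, Finset.mem_powersetCard, Finset.mem_image]
    constructor
    · rintro ⟨⟨h1, h2⟩, h3, h4⟩
      refine ⟨A.erase x, ⟨?_, ?_⟩, Finset.insert_erase h3⟩
      · intro z hz; grind
      · rw [Finset.card_erase_of_mem h3, h2]
    · rintro ⟨B, ⟨h1, h2⟩, rfl⟩
      have hxB : x ∉ B := fun h => by simpa using h1 h
      have hyB : y ∉ B := fun h => by simpa using h1 h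
      refine ⟨⟨?_, ?_⟩, ?_, ?_⟩
      · intro z hz; grind
      · rw [Finset.card_insert_of_notMem hxB]; omega
      · simp
      · simp [hyB, hxy.symm]
  rw [Finset.sum_boole, h, Finset.card_image_of_injOn, Finset.card_powersetCard,
    Finset.card_erase_of_mem (by simp [hy, hxy.symm]), Finset.card_erase_of_mem hx]
  · simp [Nat.sub_sub]
  · intro B hB C hC hBC
    have hxB : x ∉ B := fun h => by simpa using (Finset.mem_powersetCard.mp hB).1 h
    have hxC : x ∉ C := fun h => by simpa using (Finset.mem_powersetCard.mp hC).1 h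
    have := congrArg (fun D => Finset.erase D x) hBC
    simpa [hxB, hxC] using this

lemma tokenLift_swapSet (v : V → ℝ) (a b : V) (A : Finset V) :
    tokenLift v (swapSet a b A) - tokenLift v A
      = (v b - v a) * ((if a ∈ A then 1 else 0) - (if b ∈ A then 1 else 0)) := by
  have h : ∀ x, v (Equiv.swap a b x) - v x
      = (v b - v a) * ((if x = a then 1 else 0) - (if x = b then 1 else 0)) := by
    intro x
    rw [Equiv.swap_apply_def]
    split_ifs <;> simp_all
  simp only [tokenLift, swapSet, Finset.sum_map, Equiv.coe_toEmbedding]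
  rw [← Finset.sum_sub_distrib, Finset.sum_congr rfl fun x _ => h x, ← Finset.mul_sum,
    Finset.sum_sub_distrib, Finset.sum_ite_eq', Finset.sum_ite_eq']

/-- Summing the lift of a zero-sum `v` over the configurations occupying `x` recovers `v x`, up to
a factor which does not depend on `x`. -/
lemma sum_mem_tokenLift {S : Finset V} {k : ℕ} (hk : 1 ≤ k) {v : V → ℝ}
    (hv : ∑ x ∈ S, v x = 0) {x : V} (hx : x ∈ S) :
    ∑ A ∈ S.powersetCard k, (if x ∈ A then tokenLift v A else 0)
      = ((S.card - 2).choose (k - 1) : ℕ) * v x := by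
  set c : ℝ := (((S.card - 2).choose (k - 1) : ℕ) : ℝ)
  set N : ℝ := ∑ A ∈ S.powersetCard k, (if x ∈ A then (1 : ℝ) else 0)
  have h1 : ∑ A ∈ S.powersetCard k, (if x ∈ A then tokenLift v A else 0)
      = ∑ y ∈ S, v y * ∑ A ∈ S.powersetCard k, (if x ∈ A ∧ y ∈ A then (1 : ℝ) else 0) := by
    have := sum_powersetCard_sum S k fun y A => if x ∈ A then v y else 0
    simp only [tokenLift, Finset.mul_sum]
    refine Eq.trans (Finset.sum_congr rfl fun A _ => ?_) (this.trans
      (Finset.sum_congr rfl fun y _ => Finset.sum_congr rfl fun A _ => ?_))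
    · split_ifs <;> simp
    · split_ifs <;> simp_all
  have h2 : ∀ y ∈ S, v y * ∑ A ∈ S.powersetCard k, (if x ∈ A ∧ y ∈ A then (1 : ℝ) else 0)
      = (N - c) * v y + if y = x then c * v x else 0 := by
    intro y hy
    split_ifs with h
    · subst h; simp only [and_self]; ring
    · have h3 : ∑ A ∈ S.powersetCard k, (if x ∈ A ∧ y ∈ A then (1 : ℝ) else 0) = N - c := by
        rw [eq_sub_iff_add_eq, show c = _ from (sum_mem_notMem hx hy (Ne.symm h) hk).symm,
          ← Finset.sum_add_distrib]
        refine Finset.sum_congr rfl fun A _ => ?_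
        split_ifs <;> simp_all
      rw [h3]; ring
  rw [h1, Finset.sum_congr rfl h2, Finset.sum_add_distrib, ← Finset.mul_sum, hv,
    Finset.sum_ite_eq', if_pos hx]
  ring

lemma sum_tokenLift_mul (S : Finset V) (k : ℕ) (v : V → ℝ) (g : Finset V → ℝ) :
    ∑ A ∈ S.powersetCard k, tokenLift v A * g A
      = ∑ x ∈ S, v x * ∑ A ∈ S.powersetCard k, if x ∈ A then g A else 0 := by
  simp only [tokenLift, Finset.sum_mul, Finset.mul_sum]
  rw [sum_powersetCard_sum S k fun x A => v x * g A]
  simp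

lemma sum_tokenLift {S : Finset V} {k : ℕ} (hk : 1 ≤ k) {v : V → ℝ}
    (hv : ∑ x ∈ S, v x = 0) : ∑ A ∈ S.powersetCard k, tokenLift v A = 0 := by
  have h := sum_sum_mem S k (tokenLift v)
  rw [Finset.sum_congr rfl fun x hx => sum_mem_tokenLift hk hv hx, ← Finset.mul_sum, hv,
    mul_zero] at h
  exact (mul_eq_zero.mp h.symm).resolve_left (by positivity)

lemma sum_tokenLift_sq {S : Finset V} {k : ℕ} (hk : 1 ≤ k) {v : V → ℝ}
    (hv : ∑ x ∈ S, v x = 0) :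
    ∑ A ∈ S.powersetCard k, tokenLift v A ^ 2
      = ((S.card - 2).choose (k - 1) : ℕ) * ∑ x ∈ S, v x ^ 2 := by
  simp only [pow_two]
  rw [sum_tokenLift_mul, Finset.mul_sum]
  refine Finset.sum_congr rfl fun x hx => ?_
  rw [sum_mem_tokenLift hk hv hx]; ring

lemma HasTokenGap.of_card_le_one {w : V → V → ℝ} {S : Finset V} (hS : S.card ≤ 1) (l : ℝ) :
    HasTokenGap w S l := by
  intro k f hf
  have hE : 0 ≤ tokenEnergy w S k f := by
    refine le_of_eq (Eq.symm (Finset.sum_eq_zero fun a ha => Finset.sum_eq_zero fun b hb => ?_))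
    simp [Finset.card_le_one.mp hS a ha b hb, swapSet_self]
  have h0 : ∑ A ∈ S.powersetCard k, f A ^ 2 = 0 := by
    have hc : (S.powersetCard k).card ≤ 1 := by
      rw [Finset.card_powersetCard]
      interval_cases S.card <;> rcases k with _ | _ | k <;> simp [Nat.choose]
    refine Finset.sum_eq_zero fun A hA => ?_
    have := Finset.card_le_one.mp hc
    rw [Finset.eq_singleton_iff_unique_mem.mpr ⟨hA, fun B hB => this B hB A hA⟩] at hf
    simpa using hf
  rw [h0]; simpa using hE

lemma tokenEnergy_nonneg {w : V → V → ℝ} (hw : ∀ a b, 0 ≤ w a b) (S : Finset V) (k : ℕ)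
    (f : Finset V → ℝ) : 0 ≤ tokenEnergy w S k f :=
  Finset.sum_nonneg fun a _ => Finset.sum_nonneg fun b _ =>
    mul_nonneg (hw a b) (Finset.sum_nonneg fun _ _ => sq_nonneg _)

/-- Reduction to functions orthogonal to all lifts: a zero-sum `f` is the sum of the lift of
`x ↦ (∑ A ∋ x, f A) / (|S| - 2).choose (k - 1)` and of a function `g` summing to zero over the
configurations through any given vertex. Both the square norm and, edge by edge, the Dirichlet form
are additive in this decomposition. -/
lemma HasGap.hasTokenGap {w : V → V → ℝ} (hw : ∀ a b, 0 ≤ w a b) {S : Finset V} {l : ℝ}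
    (h1 : HasGap w S l)
    (h2 : ∀ (k : ℕ) (g : Finset V → ℝ), ∑ A ∈ S.powersetCard k, g A = 0 →
      (∀ x ∈ S, ∑ A ∈ S.powersetCard k, (if x ∈ A then g A else 0) = 0) →
      4 * l * ∑ A ∈ S.powersetCard k, g A ^ 2 ≤ tokenEnergy w S k g) :
    HasTokenGap w S l := by
  intro k f hf
  by_cases hk : 1 ≤ k ∧ k < S.card
  swap
  · -- There is at most one configuration, so that `f` vanishes.
    have hc : (S.powersetCard k).card ≤ 1 := by
      rw [Finset.card_powersetCard]
      rcases Nat.eq_zero_or_pos k with rfl | h0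
      · simp
      · rcases (show S.card ≤ k by by_contra h; exact hk ⟨h0, by omega⟩).lt_or_eq with h | h
        · rw [Nat.choose_eq_zero_of_lt h]; simp
        · rw [h, Nat.choose_self]
    have h0 : ∑ A ∈ S.powersetCard k, f A ^ 2 = 0 := by
      refine Finset.sum_eq_zero fun A hA => ?_
      have := Finset.card_le_one.mp hc
      rw [Finset.eq_singleton_iff_unique_mem.mpr ⟨hA, fun B hB => this B hB A hA⟩] at hf
      simpa using hf
    rw [h0, mul_zero]
    exact tokenEnergy_nonneg hw S k f
  obtain ⟨hk1, hk2⟩ := hk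
  set c : ℝ := (((S.card - 2).choose (k - 1) : ℕ) : ℝ) with hc
  have hc0 : 0 < c := by
    rw [hc]; exact_mod_cast Nat.choose_pos (by omega)
  set v : V → ℝ := fun x => (∑ A ∈ S.powersetCard k, if x ∈ A then f A else 0) / c with hvdef
  have hv : ∑ x ∈ S, v x = 0 := by
    simp only [hvdef]
    rw [← Finset.sum_div, sum_sum_mem, hf]; simp
  set g : Finset V → ℝ := fun A => f A - tokenLift v A with hg
  have hg0 : ∑ A ∈ S.powersetCard k, g A = 0 := by
    simp only [hg]
    rw [Finset.sum_sub_distrib, hf, sum_tokenLift hk1 hv, sub_zero]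
  have hg1 : ∀ x ∈ S, ∑ A ∈ S.powersetCard k, (if x ∈ A then g A else 0) = 0 := by
    intro x hx
    have h := sum_mem_tokenLift hk1 hv hx
    have h3 : c * v x = ∑ A ∈ S.powersetCard k, if x ∈ A then f A else 0 := by
      simp only [hvdef]; field_simp
    rw [← hc, h3, ← sub_eq_zero, ← Finset.sum_sub_distrib, ← neg_eq_zero,
      ← Finset.sum_neg_distrib] at h
    refine Eq.trans ?_ h
    refine Finset.sum_congr rfl fun A _ => ?_
    simp only [hg]; split_ifs <;> ring
  have hfg : ∀ A, f A = tokenLift v A + g A := fun A => by simp [hg]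
  have hnorm : ∑ A ∈ S.powersetCard k, f A ^ 2
      = c * ∑ x ∈ S, v x ^ 2 + ∑ A ∈ S.powersetCard k, g A ^ 2 := by
    have hcross : ∑ A ∈ S.powersetCard k, tokenLift v A * g A = 0 := by
      rw [sum_tokenLift_mul]
      exact Finset.sum_eq_zero fun x hx => by rw [hg1 x hx, mul_zero]
    rw [← sum_tokenLift_sq hk1 hv]
    calc _ = ∑ A ∈ S.powersetCard k,
          (tokenLift v A ^ 2 + g A ^ 2 + 2 * (tokenLift v A * g A)) :=
          Finset.sum_congr rfl fun A _ => by rw [hfg]; ring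
      _ = _ := by
        rw [Finset.sum_add_distrib, Finset.sum_add_distrib, ← Finset.mul_sum, hcross]; ring
  have hedge : ∀ a ∈ S, ∀ b ∈ S, ∑ A ∈ S.powersetCard k, (f (swapSet a b A) - f A) ^ 2
      = 2 * c * (v a - v b) ^ 2
        + ∑ A ∈ S.powersetCard k, (g (swapSet a b A) - g A) ^ 2 := by
    intro a ha b hb
    rcases eq_or_ne a b with rfl | hab
    · simp [swapSet_self]
    have hga : ∀ x ∈ S, ∑ A ∈ S.powersetCard k, (if Equiv.swap a b x ∈ A then
        g (swapSet a b A) else 0) = 0 := by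
      intro x hx
      refine Eq.trans ?_ (hg1 x hx)
      rw [← sum_swapSet ha hb k fun A => if x ∈ A then g A else 0]
      simp only [mem_swapSet]
    have hga1 := hga b hb
    have hga2 := hga a ha
    rw [Equiv.swap_apply_right] at hga1
    rw [Equiv.swap_apply_left] at hga2
    have hgb1 := hg1 a ha
    have hgb2 := hg1 b hb
    have hn1 := sum_mem_notMem ha hb hab hk1
    have hn2 := sum_mem_notMem hb ha hab.symm hk1
    rw [← hc] at hn1 hn2
    have hpt : ∀ A, (f (swapSet a b A) - f A) ^ 2
        = (v a - v b) ^ 2 * ((if a ∈ A ∧ b ∉ A then (1 : ℝ) else 0)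
            + (if b ∈ A ∧ a ∉ A then (1 : ℝ) else 0))
          + (g (swapSet a b A) - g A) ^ 2
          + 2 * (v b - v a) * ((if a ∈ A then g (swapSet a b A) else 0)
              - (if b ∈ A then g (swapSet a b A) else 0)
              - (if a ∈ A then g A else 0) + (if b ∈ A then g A else 0)) := by
      intro A
      have h := tokenLift_swapSet v a b A
      rw [show f (swapSet a b A) - f A = (tokenLift v (swapSet a b A) - tokenLift v A)
        + (g (swapSet a b A) - g A) by rw [hfg, hfg A]; ring, h]
      by_cases haA : a ∈ A <;> by_cases hbA : b ∈ A <;> simp [haA, hbA] <;> ring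
    -- The cross terms vanish: both `g` and `A ↦ g (swapSet a b A)` have sum zero over the
    -- configurations through `a` and over those through `b`.
    rw [Finset.sum_congr rfl fun A _ => hpt A]
    simp only [Finset.sum_add_distrib, ← Finset.mul_sum, Finset.sum_sub_distrib]
    rw [hga1, hga2, hgb1, hgb2, hn1, hn2]
    ring
  have hE : tokenEnergy w S k f
      = 2 * c * (∑ a ∈ S, ∑ b ∈ S, w a b * (v a - v b) ^ 2) + tokenEnergy w S k g := by
    simp only [tokenEnergy]
    rw [Finset.mul_sum, ← Finset.sum_add_distrib]
    refine Finset.sum_congr rfl fun a ha => ?_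
    rw [Finset.mul_sum, ← Finset.sum_add_distrib]
    refine Finset.sum_congr rfl fun b hb => ?_
    rw [hedge a ha b hb]; ring
  rw [hE, hnorm]
  have := mul_le_mul_of_nonneg_left (h1 v hv) (show 0 ≤ 2 * c by positivity)
  have := h2 k g hg0 hg1
  linarith

end

/-! ### Deleting vertices -/

section
variable {V : Type*} [DecidableEq V]

lemma sum_powersetCard_succ_insert {T : Finset V} {x : V} (hx : x ∉ T) (k : ℕ)
    (F : Finset V → ℝ) :
    ∑ A ∈ (insert x T).powersetCard (k + 1), F A
      = ∑ A ∈ T.powersetCard (k + 1), F A + ∑ A ∈ T.powersetCard k, F (insert x A) := by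
  have hmem : ∀ {j : ℕ} {A : Finset V}, A ∈ T.powersetCard j → x ∉ A := fun hA h =>
    hx ((Finset.mem_powersetCard.mp hA).1 h)
  rw [Finset.powersetCard_succ_insert hx, Finset.sum_union, Finset.sum_image]
  · intro A hA B hB h
    have := congrArg (fun D => Finset.erase D x) h
    simpa [hmem hA, hmem hB] using this
  · rw [Finset.disjoint_left]
    intro A hA hA'
    obtain ⟨B, _, rfl⟩ := Finset.mem_image.mp hA'
    exact hmem hA (Finset.mem_insert_self x B)

/-- If `f` has sum zero over the configurations occupying `x`, and over all configurations, then the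
gap of the process on `S \ {x}` controls `f` through the edges avoiding `x` only: condition on
whether `x` is occupied. -/
lemma HasTokenGap.le_sum_erase {w : V → V → ℝ} {S : Finset V} {x : V} (hxS : x ∈ S) {m : ℝ}
    (h : HasTokenGap w (S.erase x) m) {k : ℕ} {f : Finset V → ℝ}
    (hf : ∑ A ∈ S.powersetCard k, f A = 0)
    (hfx : ∑ A ∈ S.powersetCard k, (if x ∈ A then f A else 0) = 0) :
    4 * m * ∑ A ∈ S.powersetCard k, f A ^ 2
      ≤ ∑ a ∈ S.erase x, ∑ b ∈ S.erase x,
          w a b * ∑ A ∈ S.powersetCard k, (f (swapSet a b A) - f A) ^ 2 := by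
  obtain ⟨T, hxT, rfl⟩ : ∃ T, x ∉ T ∧ S = insert x T :=
    ⟨S.erase x, Finset.notMem_erase x S, (Finset.insert_erase hxS).symm⟩
  rw [Finset.erase_insert hxT] at h ⊢
  have hne : ∀ {a : V}, a ∈ T → x ≠ a := fun ha e => hxT (e ▸ ha)
  rcases k with _ | k
  · have h0 := h 0 f (by simpa using hf)
    simpa [tokenEnergy] using h0
  rw [sum_powersetCard_succ_insert hxT] at hf hfx
  have hmem : ∀ A ∈ T.powersetCard (k + 1), x ∉ A := fun A hA h =>
    hxT ((Finset.mem_powersetCard.mp hA).1 h)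
  rw [Finset.sum_congr rfl fun A hA => if_neg (hmem A hA)] at hfx
  simp only [Finset.sum_const_zero, zero_add, Finset.mem_insert_self, if_true] at hfx
  rw [hfx, add_zero] at hf
  have e1 := h (k + 1) f hf
  have e2 := h k (fun A => f (insert x A)) hfx
  rw [sum_powersetCard_succ_insert hxT, mul_add]
  refine (add_le_add e1 e2).trans (le_of_eq ?_)
  simp only [tokenEnergy]
  rw [← Finset.sum_add_distrib]
  refine Finset.sum_congr rfl fun a ha => ?_
  rw [← Finset.sum_add_distrib]
  refine Finset.sum_congr rfl fun b hb => ?_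
  rw [sum_powersetCard_succ_insert hxT, mul_add]
  simp only [swapSet_insert (hne ha) (hne hb)]

/-- The inductive step for the token gap: delete each vertex `x ∈ X` in turn and average. Every edge
survives at most `d` of the `|X|` deletions. -/
lemma HasGap.hasTokenGap_of_erase {w : V → V → ℝ} (hw : ∀ a b, 0 ≤ w a b) {S : Finset V} {l : ℝ}
    (hgap : HasGap w S l) {X : Finset V} (hX : X ⊆ S) {m : ℝ}
    (hdel : ∀ x ∈ X, HasTokenGap w (S.erase x) m) {d : ℕ} (hd : 0 < d)
    (hcount : ∀ a ∈ S, ∀ b ∈ S, a ≠ b → w a b ≠ 0 →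
      (X.filter fun x => x ≠ a ∧ x ≠ b).card ≤ d)
    (hl : d * l ≤ X.card * m) : HasTokenGap w S l := by
  refine hgap.hasTokenGap hw fun k g hg hgx => ?_
  set T : V → V → ℝ := fun a b =>
    w a b * ∑ A ∈ S.powersetCard k, (g (swapSet a b A) - g A) ^ 2 with hT
  set Q := ∑ A ∈ S.powersetCard k, g A ^ 2 with hQ
  have hQ0 : 0 ≤ Q := Finset.sum_nonneg fun _ _ => sq_nonneg _
  have hT0 : ∀ a b, 0 ≤ T a b := fun a b =>
    mul_nonneg (hw a b) (Finset.sum_nonneg fun _ _ => sq_nonneg _)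
  have h1 : X.card * (4 * m * Q) ≤ ∑ x ∈ X, ∑ a ∈ S.erase x, ∑ b ∈ S.erase x, T a b := by
    rw [← nsmul_eq_mul]
    exact Finset.card_nsmul_le_sum _ _ _ fun x hx =>
      (hdel x hx).le_sum_erase (hX hx) hg (hgx x (hX hx))
  have h2 : ∑ x ∈ X, ∑ a ∈ S.erase x, ∑ b ∈ S.erase x, T a b
      = ∑ a ∈ S, ∑ b ∈ S, (X.filter fun x => x ≠ a ∧ x ≠ b).card * T a b := by
    have : ∀ x, ∑ a ∈ S.erase x, ∑ b ∈ S.erase x, T a b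
        = ∑ a ∈ S, ∑ b ∈ S, if x ≠ a ∧ x ≠ b then T a b else 0 := by
      intro x
      simp only [← Finset.filter_ne, Finset.sum_filter]
      refine Finset.sum_congr rfl fun a _ => ?_
      split_ifs with h
      · simp [h]
      · simp [h]
    simp only [this]
    rw [Finset.sum_comm]
    refine Finset.sum_congr rfl fun a _ => ?_
    rw [Finset.sum_comm]
    refine Finset.sum_congr rfl fun b _ => ?_
    rw [← Finset.sum_filter, Finset.sum_const, nsmul_eq_mul]
  have h3 : ∑ a ∈ S, ∑ b ∈ S, (X.filter fun x => x ≠ a ∧ x ≠ b).card * T a b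
      ≤ d * tokenEnergy w S k g := by
    rw [tokenEnergy, Finset.mul_sum]
    refine Finset.sum_le_sum fun a ha => ?_
    rw [Finset.mul_sum]
    refine Finset.sum_le_sum fun b hb => ?_
    by_cases h : a ≠ b ∧ w a b ≠ 0
    · exact mul_le_mul_of_nonneg_right (by exact_mod_cast hcount a ha b hb h.1 h.2) (hT0 a b)
    · have h0 : T a b = 0 := by
        rcases not_and_or.mp h with h | h
        · rw [not_not] at h; subst h; simp [hT, swapSet_self]
        · rw [not_not] at h; simp [hT, h]
      have h0' : w a b * ∑ A ∈ S.powersetCard k, (g (swapSet a b A) - g A) ^ 2 = 0 := h0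
      rw [h0, h0', mul_zero, mul_zero]
  have hd' : (0 : ℝ) < d := by exact_mod_cast hd
  refine le_of_mul_le_mul_left ?_ hd'
  calc (d : ℝ) * (4 * l * Q) = 4 * Q * (d * l) := by ring
    _ ≤ 4 * Q * (X.card * m) := mul_le_mul_of_nonneg_left hl (by positivity)
    _ = X.card * (4 * m * Q) := by ring
    _ ≤ _ := h1
    _ = _ := h2
    _ ≤ _ := h3

/-! ### Complete graphs -/

lemma sum_sum_sub_sq {U : Type*} (S T : Finset U) (v : U → ℝ) :
    ∑ a ∈ S, ∑ b ∈ T, (v a - v b) ^ 2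
      = T.card * ∑ a ∈ S, v a ^ 2 + S.card * ∑ b ∈ T, v b ^ 2
        - 2 * (∑ a ∈ S, v a) * ∑ b ∈ T, v b := by
  have : ∀ a b, (v a - v b) ^ 2 = v a ^ 2 + v b ^ 2 - 2 * (v a * v b) := fun a b => by ring
  simp only [this, Finset.sum_sub_distrib, Finset.sum_add_distrib, Finset.sum_const, nsmul_eq_mul,
    ← Finset.mul_sum, ← Finset.sum_mul]
  ring

lemma hasGap_complete (S : Finset V) :
    HasGap (fun a b : V => if a ≠ b then 1 else 0) S S.card := by
  intro v hv
  have : ∀ a b : V, (if a ≠ b then (1 : ℝ) else 0) * (v a - v b) ^ 2 = (v a - v b) ^ 2 := by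
    intro a b
    by_cases h : a = b <;> simp [h]
  simp only [this]
  rw [sum_sum_sub_sq, hv]
  exact le_of_eq (by ring)

lemma hasTokenGap_complete (S : Finset V) :
    HasTokenGap (fun a b : V => if a ≠ b then 1 else 0) S S.card := by
  have hw : ∀ a b : V, (0 : ℝ) ≤ if a ≠ b then 1 else 0 := fun a b => by positivity
  induction h : S.card using Nat.strong_induction_on generalizing S with
  | _ N ih =>
    rcases Nat.lt_or_ge 1 N with hN | hN
    swap
    · exact .of_card_le_one (h ▸ hN) _
    have hgap := hasGap_complete S
    rw [h] at hgap
    rcases (show N = 2 ∨ 3 ≤ N by omega) with rfl | hN3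
    · refine hgap.hasTokenGap_of_erase hw subset_rfl (m := 2) (d := 2)
        (fun x hx => .of_card_le_one (by rw [Finset.card_erase_of_mem hx, h]) _) two_pos
        (fun a _ b _ _ _ => (Finset.card_filter_le _ _).trans h.le) (by rw [h]; norm_num)
    · refine hgap.hasTokenGap_of_erase hw subset_rfl (m := (N - 1 : ℕ)) (d := N - 2)
        (fun x hx => ih (N - 1) (by omega) _ (by rw [Finset.card_erase_of_mem hx, h]))
        (by omega) (fun a ha b hb hab _ => ?_) ?_
      · have : S.filter (fun x => x ≠ a ∧ x ≠ b) = (S.erase a).erase b := by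
          ext x; simp only [Finset.mem_filter, Finset.mem_erase]; tauto
        rw [this, Finset.card_erase_of_mem (by simp [hb, hab.symm]), Finset.card_erase_of_mem ha, h]
        omega
      · rw [h, Nat.cast_sub (by omega), Nat.cast_sub (by omega)]
        push_cast
        linarith

/-! ### Complete bipartite graphs -/

lemma hasGap_bipartite {U : Type*} (χ : U → Bool) (S : Finset U) {l : ℕ}
    (hl : ∀ c, l ≤ (S.filter fun x => χ x = c).card) :
    HasGap (fun a b : U => if χ a ≠ χ b then 1 else 0) S l := by
  intro v hv
  set S₁ := S.filter fun x => χ x = true with hS₁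
  set S₂ := S.filter fun x => χ x = false with hS₂
  have hsplit : ∀ F : U → ℝ, ∑ x ∈ S, F x = ∑ x ∈ S₁, F x + ∑ x ∈ S₂, F x := by
    intro F
    rw [← Finset.sum_filter_add_sum_filter_not S fun x => χ x = true]
    simp only [Bool.not_eq_true]
    rfl
  have h1 : ∀ x ∈ S₁, χ x = true := fun x hx => (Finset.mem_filter.mp hx).2
  have h2 : ∀ x ∈ S₂, χ x = false := fun x hx => (Finset.mem_filter.mp hx).2
  have hE : ∑ a ∈ S, ∑ b ∈ S, (if χ a ≠ χ b then (1 : ℝ) else 0) * (v a - v b) ^ 2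
      = ∑ a ∈ S₁, ∑ b ∈ S₂, (v a - v b) ^ 2 + ∑ a ∈ S₂, ∑ b ∈ S₁, (v a - v b) ^ 2 := by
    rw [hsplit]
    congr 1
    · refine Finset.sum_congr rfl fun a ha => ?_
      rw [hsplit, Finset.sum_eq_zero fun b hb => by simp [h1 a ha, h1 b hb], zero_add]
      exact Finset.sum_congr rfl fun b hb => by simp [h1 a ha, h2 b hb]
    · refine Finset.sum_congr rfl fun a ha => ?_
      rw [hsplit, add_comm, Finset.sum_eq_zero fun b hb => by simp [h2 a ha, h2 b hb], zero_add]
      exact Finset.sum_congr rfl fun b hb => by simp [h2 a ha, h1 b hb]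
  rw [hE, sum_sum_sub_sq, sum_sum_sub_sq, hsplit]
  rw [hsplit] at hv
  have hn1 : (l : ℝ) ≤ S₁.card := by exact_mod_cast hl true
  have hn2 : (l : ℝ) ≤ S₂.card := by exact_mod_cast hl false
  have q1 : 0 ≤ ∑ x ∈ S₁, v x ^ 2 := Finset.sum_nonneg fun _ _ => sq_nonneg _
  have q2 : 0 ≤ ∑ x ∈ S₂, v x ^ 2 := Finset.sum_nonneg fun _ _ => sq_nonneg _
  rw [eq_neg_of_add_eq_zero_right hv]
  nlinarith [mul_le_mul_of_nonneg_right hn2 q1, mul_le_mul_of_nonneg_right hn1 q2,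
    sq_nonneg (∑ x ∈ S₁, v x)]

/-- Induction for complete bipartite graphs: delete the vertices of a largest class `X`. -/
lemma hasTokenGap_bipartite (χ : V → Bool) (S : Finset V) {l : ℕ}
    (hl : ∀ c, l ≤ (S.filter fun x => χ x = c).card) :
    HasTokenGap (fun a b : V => if χ a ≠ χ b then 1 else 0) S l := by
  have hw : ∀ a b : V, (0 : ℝ) ≤ if χ a ≠ χ b then 1 else 0 := fun a b => by positivity
  induction h : S.card using Nat.strong_induction_on generalizing S l with
  | _ N ih =>
    rcases Nat.eq_zero_or_pos l with rfl | hl0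
    · intro k f _
      simpa using tokenEnergy_nonneg hw S k f
    have hgap := hasGap_bipartite χ S hl
    obtain ⟨c, hc⟩ : ∃ c, (S.filter fun x => χ x = !c).card ≤ (S.filter fun x => χ x = c).card := by
      rcases le_total (S.filter fun x => χ x = false).card (S.filter fun x => χ x = true).card
        with h | h
      · exact ⟨true, h⟩
      · exact ⟨false, h⟩
    set X := S.filter fun x => χ x = c with hXdef
    have hXS : X ⊆ S := Finset.filter_subset _ _
    have hcard : N = X.card + (S.filter fun x => χ x = !c).card := by
      rw [← h, ← Finset.card_filter_add_card_filter_not (s := S) fun x => χ x = c]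
      simp only [hXdef, Bool.eq_not]
    have hlX : l ≤ X.card := hl c
    have herase : ∀ x ∈ X, ∀ j : ℕ, j ≤ l → j + 1 ≤ X.card → ∀ c',
        j ≤ ((S.erase x).filter fun y => χ y = c').card := by
      intro x hx j hj hj' c'
      rw [Finset.filter_erase]
      rcases eq_or_ne c' c with rfl | hne
      · rw [Finset.card_erase_of_mem hx]; exact Nat.le_sub_of_add_le hj'
      · rw [Finset.erase_eq_of_notMem]
        · exact hj.trans (hl c')
        · rw [Finset.mem_filter]
          rintro ⟨_, h2⟩
          exact hne (h2.symm.trans (Finset.mem_filter.mp hx).2)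
    have hcN : ∀ x ∈ X, (S.erase x).card = N - 1 := fun x hx => by
      rw [Finset.card_erase_of_mem (hXS hx), h]
    have hcount : ∀ a ∈ S, ∀ b ∈ S, (if χ a ≠ χ b then (1 : ℝ) else 0) ≠ 0 →
        (X.filter fun x => x ≠ a ∧ x ≠ b).card ≤ X.card - 1 := by
      intro a ha b hb hab
      have hab : χ a ≠ χ b := by
        by_contra h'
        simp [h'] at hab
      obtain ⟨y, hyX, hy⟩ : ∃ y ∈ X, y = a ∨ y = b := by
        by_cases hca : χ a = c
        · exact ⟨a, by simp [hXdef, ha, hca], .inl rfl⟩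
        · refine ⟨b, ?_, .inr rfl⟩
          simp only [hXdef, Finset.mem_filter, hb, true_and]
          cases hχa : χ a <;> cases hχb : χ b <;> cases c <;> simp_all
      rw [← Finset.card_erase_of_mem hyX]
      refine Finset.card_le_card fun x hx => ?_
      rw [Finset.mem_filter] at hx
      refine Finset.mem_erase.mpr ⟨?_, hx.1⟩
      rcases hy with rfl | rfl
      · exact hx.2.1
      · exact hx.2.2
    rcases hlX.lt_or_eq with hlt | heq
    · -- The smaller class still has at least `l` vertices, and so has `X` after a deletion.
      refine hgap.hasTokenGap_of_erase hw hXS (m := l) (d := X.card - 1)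
        (fun x hx => ih (N - 1) (by omega) _ (herase x hx l le_rfl hlt) (hcN x hx))
        (by omega) (fun a ha b hb _ => hcount a ha b hb) ?_
      exact mul_le_mul_of_nonneg_right (by exact_mod_cast Nat.sub_le _ _) (Nat.cast_nonneg _)
    · rcases (show l = 1 ∨ 2 ≤ l by omega) with rfl | hl2
      · refine hgap.hasTokenGap_of_erase hw hXS (m := 1) (d := 1)
          (fun x hx => .of_card_le_one (by rw [hcN x hx]; omega) _) one_pos
          (fun a ha b hb _ hab => (hcount a ha b hb hab).trans (by omega)) (by simp [← heq])
      · -- Both classes have `l` vertices, so that one deletion lowers the bound to `l - 1`.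
        refine hgap.hasTokenGap_of_erase hw hXS (m := (l - 1 : ℕ)) (d := X.card - 1)
          (fun x hx => ih (N - 1) (by omega) _
            (herase x hx (l - 1) (Nat.sub_le _ _) (by omega)) (hcN x hx))
          (by omega) (fun a ha b hb _ => hcount a ha b hb) ?_
        rw [← heq]
        exact le_of_eq (mul_comm _ _)

end

/-! ### Laplacians of graphs and of token graphs -/

open Classical in
/-- The edge weights of a graph: `1` on adjacent pairs and `0` elsewhere. -/
noncomputable def adjWeight {V : Type*} (G : SimpleGraph V) (a b : V) : ℝ :=
  if G.Adj a b then 1 else 0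

section
variable {V : Type*}

lemma adjWeight_comm (G : SimpleGraph V) (a b : V) : adjWeight G a b = adjWeight G b a := by
  classical exact if_congr (G.adj_comm a b) rfl rfl

lemma adjWeight_nonneg (G : SimpleGraph V) (a b : V) : 0 ≤ adjWeight G a b := by
  unfold adjWeight; split_ifs <;> norm_num

open Classical in
lemma lapMatrix_mulVec_eq_sum [Fintype V] (G : SimpleGraph V) (v : V → ℝ) (x : V) :
    (G.lapMatrix ℝ).mulVec v x = ∑ y, adjWeight G x y * (v x - v y) := by
  rw [SimpleGraph.lapMatrix_mulVec_apply, ← SimpleGraph.card_neighborFinset_eq_degree,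
    ← nsmul_eq_mul, ← Finset.sum_const, ← Finset.sum_sub_distrib,
    SimpleGraph.neighborFinset_eq_filter, Finset.sum_filter]
  exact Finset.sum_congr rfl fun y _ => by unfold adjWeight; split_ifs <;> simp

lemma mem_lapEigenvaluesOnW [Fintype V] {G : SimpleGraph V} {μ : ℝ} :
    μ ∈ lapEigenvaluesOnW G ↔ ∃ v : V → ℝ, v ≠ 0 ∧ ∑ x, v x = 0 ∧
      ∀ x, ∑ y, adjWeight G x y * (v x - v y) = μ * v x := by
  simp only [lapEigenvaluesOnW, Set.mem_ofPred_eq, funext_iff (f := Matrix.mulVec _ _),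
    lapMatrix_mulVec_eq_sum, Pi.smul_apply, smul_eq_mul]

lemma sum_sq_pos [Fintype V] {v : V → ℝ} (hv : v ≠ 0) : 0 < ∑ x, v x ^ 2 := by
  obtain ⟨x, hx⟩ := Function.ne_iff.mp hv
  exact Finset.sum_pos' (fun _ _ => sq_nonneg _) ⟨x, Finset.mem_univ x, sq_pos_of_ne_zero hx⟩

lemma HasGap.le_of_mem [Fintype V] {G : SimpleGraph V} {l μ : ℝ}
    (h : HasGap (adjWeight G) Finset.univ l) (hμ : μ ∈ lapEigenvaluesOnW G) : l ≤ μ := by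
  obtain ⟨v, hv0, hv1, hv⟩ := mem_lapEigenvaluesOnW.mp hμ
  have h1 := h v hv1
  have h2 : ∑ a, ∑ b, adjWeight G a b * (v a - v b) ^ 2 = 2 * (μ * ∑ x, v x ^ 2) := by
    have e1 : ∑ a, ∑ b, adjWeight G a b * (v a - v b) * v a = μ * ∑ x, v x ^ 2 := by
      rw [Finset.mul_sum]
      refine Finset.sum_congr rfl fun a _ => ?_
      rw [← Finset.sum_mul, hv]; ring
    have e2 : ∑ a, ∑ b, adjWeight G a b * (v b - v a) * v b = μ * ∑ x, v x ^ 2 := by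
      rw [← e1, Finset.sum_comm]
      exact Finset.sum_congr rfl fun a _ => Finset.sum_congr rfl fun b _ => by
        rw [adjWeight_comm]
    rw [two_mul]
    nth_rw 1 [← e1]
    rw [← e2, ← Finset.sum_add_distrib]
    refine Finset.sum_congr rfl fun a _ => ?_
    rw [← Finset.sum_add_distrib]
    exact Finset.sum_congr rfl fun b _ => by ring
  rw [h2] at h1
  exact le_of_mul_le_mul_right (by linarith) (sum_sq_pos hv0)

variable [DecidableEq V]

lemma symmDiff_swapSet {a b : V} {A : Finset V} (ha : a ∈ A) (hb : b ∉ A) :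
    symmDiff A (swapSet a b A) = {a, b} := by
  ext x
  rw [Finset.mem_symmDiff, mem_swapSet, Equiv.swap_apply_def]
  grind

/-- A configuration `B` with `A ∆ B = {a, b}`, where `a ∈ A` and `b ∈ B`, is obtained from `A` by
moving the token at `a` to `b`. -/
lemma eq_swapSet {a b : V} {A B : Finset V} (ha : a ∈ A) (hb : b ∈ B)
    (h : symmDiff A B = {a, b}) : a ∉ B ∧ b ∉ A ∧ B = swapSet a b A := by
  have hx : ∀ x, (x ∈ A ∧ x ∉ B ∨ x ∈ B ∧ x ∉ A) ↔ x = a ∨ x = b := fun x => by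
    rw [← Finset.mem_symmDiff, h]; simp
  have h1 : a ∉ B := by have := hx a; grind
  have h2 : b ∉ A := by have := hx b; grind
  refine ⟨h1, h2, ?_⟩
  ext x
  rw [mem_swapSet, Equiv.swap_apply_def]
  have := hx x
  grind

variable [Fintype V]

/-- The token graph Laplacian, as a sum over the ordered pairs of vertices of `G`. Every move along
an edge appears for both orders of the end points, hence the factor `2`. -/
lemma sum_adjWeight_tokenGraph (G : SimpleGraph V) (k : ℕ) (F : Finset V → ℝ)
    (A : {A : Finset V // A.card = k}) :
    2 * ∑ B, adjWeight (tokenGraph G k) A B * (F A - F B)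
      = ∑ a, ∑ b, adjWeight G a b * (F A - F (swapSet a b A)) := by
  classical
  obtain ⟨A, hA⟩ := A
  set T : V → V → ℝ := fun a b => adjWeight G a b * (F A - F (swapSet a b A)) with hT
  have hTc : ∀ a b, T a b = T b a := fun a b => by
    simp only [hT]; rw [adjWeight_comm, swapSet_comm]
  have hsplit : ∀ a b, T a b = (if a ∈ A ∧ b ∉ A then T a b else 0)
      + (if b ∈ A ∧ a ∉ A then T b a else 0) := by
    intro a b
    by_cases ha : a ∈ A <;> by_cases hb : b ∈ A
    · simp [ha, hb, hT, swapSet_eq_self (iff_of_true ha hb)]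
    · simp [ha, hb]
    · simpa [ha, hb] using hTc a b
    · simp [ha, hb, hT, swapSet_eq_self (iff_of_false ha hb)]
  have hsum : ∑ a, ∑ b, T a b = 2 * ∑ a, ∑ b, if a ∈ A ∧ b ∉ A then T a b else 0 := by
    rw [Finset.sum_congr rfl fun a _ => Finset.sum_congr rfl fun b _ => hsplit a b]
    simp only [Finset.sum_add_distrib]
    rw [Finset.sum_comm (f := fun a b => if b ∈ A ∧ a ∉ A then T b a else 0), two_mul]
  change _ = ∑ a, ∑ b, T a b
  rw [hsum]
  congr 1
  rw [← Finset.sum_product', ← Finset.sum_filter_ne_zero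
    (s := (Finset.univ : Finset {A : Finset V // A.card = k})),
    ← Finset.sum_filter_ne_zero (s := Finset.univ ×ˢ Finset.univ)]
  have hmove : ∀ p : V × V, p.1 ∈ A ∧ p.2 ∉ A → G.Adj p.1 p.2 →
      (tokenGraph G k).Adj ⟨A, hA⟩ ⟨swapSet p.1 p.2 A, (card_swapSet _ _ _).trans hA⟩ := by
    intro p hp hadj
    exact ⟨p.1, hp.1, p.2, by simp [mem_swapSet, hp.1], symmDiff_swapSet hp.1 hp.2, hadj⟩
  symm
  refine Finset.sum_bij
    (fun p _ => ⟨swapSet p.1 p.2 A, (card_swapSet _ _ _).trans hA⟩) ?_ ?_ ?_ ?_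
  · intro p hp
    have hp' := (Finset.mem_filter.mp hp).2
    have hc : p.1 ∈ A ∧ p.2 ∉ A := by by_contra h; exact hp' (if_neg h)
    rw [if_pos hc] at hp'
    have hadj : G.Adj p.1 p.2 := by
      by_contra h; exact hp' (by simp [hT, adjWeight, h])
    refine Finset.mem_filter.mpr ⟨Finset.mem_univ _, ?_⟩
    simpa [hT, adjWeight, hadj, hmove p hc hadj] using hp'
  · intro p hp q hq hpq
    have hp' := (Finset.mem_filter.mp hp).2
    have hq' := (Finset.mem_filter.mp hq).2
    have hcp : p.1 ∈ A ∧ p.2 ∉ A := by by_contra h; exact hp' (if_neg h)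
    have hcq : q.1 ∈ A ∧ q.2 ∉ A := by by_contra h; exact hq' (if_neg h)
    have e := congrArg Subtype.val hpq
    have e' : ({p.1, p.2} : Finset V) = {q.1, q.2} := by
      rw [← symmDiff_swapSet hcp.1 hcp.2, ← symmDiff_swapSet hcq.1 hcq.2]
      exact congrArg _ e
    have m1 : p.1 ∈ ({q.1, q.2} : Finset V) := by rw [← e']; simp
    have m2 : p.2 ∈ ({q.1, q.2} : Finset V) := by rw [← e']; simp
    simp only [Finset.mem_insert, Finset.mem_singleton] at m1 m2
    refine Prod.ext ?_ ?_ <;> grind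
  · rintro ⟨B, hB⟩ hBf
    have hB' := (Finset.mem_filter.mp hBf).2
    have hadj : (tokenGraph G k).Adj ⟨A, hA⟩ ⟨B, hB⟩ := by
      by_contra h; exact hB' (by simp [adjWeight, h])
    obtain ⟨a, ha, b, hb, hs, hab⟩ := hadj
    obtain ⟨_, hbA, rfl⟩ := eq_swapSet ha hb hs
    refine ⟨(a, b), ?_, rfl⟩
    refine Finset.mem_filter.mpr ⟨by simp, ?_⟩
    rw [if_pos ⟨ha, hbA⟩]
    simpa [hT, adjWeight, hab, hmove (a, b) ⟨ha, hbA⟩ hab] using hB'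
  · intro p hp
    have hp' := (Finset.mem_filter.mp hp).2
    have hc : p.1 ∈ A ∧ p.2 ∉ A := by by_contra h; exact hp' (if_neg h)
    rw [if_pos hc] at hp' ⊢
    have hadj : G.Adj p.1 p.2 := by
      by_contra h; exact hp' (by simp [hT, adjWeight, h])
    simp [hT, adjWeight, hadj, hmove p hc hadj]

lemma sum_token_eq {U : Type*} [Fintype U] (k : ℕ) (F : Finset U → ℝ) :
    ∑ A : {A : Finset U // A.card = k}, F A = ∑ A ∈ Finset.univ.powersetCard k, F A :=
  (Finset.sum_subtype _ (fun _ => Finset.mem_powersetCard_univ) F).symm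

lemma HasTokenGap.le_of_mem {G : SimpleGraph V} {l μ : ℝ} {k : ℕ}
    (h : HasTokenGap (adjWeight G) Finset.univ l)
    (hμ : μ ∈ lapEigenvaluesOnW (tokenGraph G k)) : l ≤ μ := by
  obtain ⟨f, hf0, hf1, hf⟩ := mem_lapEigenvaluesOnW.mp hμ
  set F : Finset V → ℝ := fun A => if hA : A.card = k then f ⟨A, hA⟩ else 0 with hF
  have hFf : ∀ A : {A : Finset V // A.card = k}, f A = F A := fun A => by simp [hF, A.2]
  simp only [hFf] at hf1 hf
  have hpos : 0 < ∑ A ∈ Finset.univ.powersetCard k, F A ^ 2 := by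
    rw [← sum_token_eq k fun A => F A ^ 2]
    simpa only [hFf] using sum_sq_pos hf0
  have hsum : ∑ A ∈ Finset.univ.powersetCard k, F A = 0 := by rw [← sum_token_eq k F, hf1]
  have h1 := h k F hsum
  have hE : ∑ A ∈ Finset.univ.powersetCard k,
      (∑ a, ∑ b, adjWeight G a b * (F A - F (swapSet a b A))) * F A
        = 2 * (μ * ∑ A ∈ Finset.univ.powersetCard k, F A ^ 2) := by
    rw [← sum_token_eq k fun A => (∑ a, ∑ b, adjWeight G a b * (F A - F (swapSet a b A))) * F A,
      ← sum_token_eq k fun A => F A ^ 2, Finset.mul_sum, Finset.mul_sum]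
    refine Finset.sum_congr rfl fun A _ => ?_
    rw [← sum_adjWeight_tokenGraph, hf]; ring
  have hE2 : tokenEnergy (adjWeight G) Finset.univ k F
      = 2 * ∑ A ∈ Finset.univ.powersetCard k,
        (∑ a, ∑ b, adjWeight G a b * (F A - F (swapSet a b A))) * F A := by
    simp only [Finset.sum_mul]
    rw [Finset.sum_comm, tokenEnergy, Finset.mul_sum]
    refine Finset.sum_congr rfl fun a _ => ?_
    rw [Finset.sum_comm, Finset.mul_sum]
    refine Finset.sum_congr rfl fun b _ => ?_
    have hsq := sum_swapSet (Finset.mem_univ a) (Finset.mem_univ b) k fun A => F A ^ 2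
    rw [Finset.mul_sum, Finset.mul_sum]
    have : ∀ A, adjWeight G a b * (F (swapSet a b A) - F A) ^ 2
        = 2 * (adjWeight G a b * (F A - F (swapSet a b A)) * F A)
          + adjWeight G a b * (F (swapSet a b A) ^ 2 - F A ^ 2) := fun A => by ring
    rw [Finset.sum_congr rfl fun A _ => this A, Finset.sum_add_distrib,
      ← Finset.mul_sum (a := adjWeight G a b), Finset.sum_sub_distrib, hsq, sub_self, mul_zero,
      add_zero]
  rw [hE2, hE] at h1
  exact le_of_mul_le_mul_right (by linarith) hpos

/-- Laplacian eigenvectors of `G` lift to Laplacian eigenvectors of the token graph. -/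
lemma mem_lapEigenvaluesOnW_tokenGraph {G : SimpleGraph V} {k : ℕ} (hk : 1 ≤ k)
    (hk' : k < Fintype.card V) {μ : ℝ} (hμ : μ ∈ lapEigenvaluesOnW G) :
    μ ∈ lapEigenvaluesOnW (tokenGraph G k) := by
  obtain ⟨v, hv0, hv1, hv⟩ := mem_lapEigenvaluesOnW.mp hμ
  refine mem_lapEigenvaluesOnW.mpr ⟨fun A => tokenLift v A, ?_, ?_, ?_⟩
  · intro h0
    have h1 := sum_tokenLift_sq hk hv1
    rw [← sum_token_eq k fun A => tokenLift v A ^ 2] at h1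
    have h2 : ∀ A : {A : Finset V // A.card = k}, tokenLift v A = 0 := fun A => congrFun h0 A
    simp only [h2] at h1
    have h3 : 0 < (Finset.univ.card (α := V) - 2).choose (k - 1) :=
      Nat.choose_pos (by rw [Finset.card_univ]; omega)
    have h4 : 0 < ((((Finset.univ.card (α := V) - 2).choose (k - 1) : ℕ)) : ℝ) * ∑ x, v x ^ 2 :=
      mul_pos (by exact_mod_cast h3) (sum_sq_pos hv0)
    rw [← h1] at h4
    simp at h4
  · rw [sum_token_eq k (tokenLift v)]
    exact sum_tokenLift hk hv1
  · intro A
    have h2 := sum_adjWeight_tokenGraph G k (tokenLift v) A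
    have h3 : ∑ a, ∑ b, adjWeight G a b * (tokenLift v A - tokenLift v (swapSet a b A))
        = 2 * (μ * tokenLift v A) := by
      have e1 : ∑ a, ∑ b, adjWeight G a b * (v a - v b) * (if a ∈ A.1 then 1 else 0)
          = μ * tokenLift v A := by
        simp only [← Finset.sum_mul, hv]
        simp only [mul_ite, mul_one, mul_zero]
        rw [← Finset.sum_filter, tokenLift, Finset.mul_sum]
        simp
      have e2 : ∑ a, ∑ b, adjWeight G a b * (v b - v a) * (if b ∈ A.1 then 1 else 0)
          = μ * tokenLift v A := by
        rw [← e1, Finset.sum_comm]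
        exact Finset.sum_congr rfl fun a _ => Finset.sum_congr rfl fun b _ => by
          rw [adjWeight_comm]
      rw [two_mul]
      nth_rw 1 [← e1]
      rw [← e2, ← Finset.sum_add_distrib]
      refine Finset.sum_congr rfl fun a _ => ?_
      rw [← Finset.sum_add_distrib]
      refine Finset.sum_congr rfl fun b _ => ?_
      rw [← neg_sub (tokenLift v (swapSet a b A)), tokenLift_swapSet]
      ring
    linarith

/-- If `l` is a Laplacian eigenvalue of `G` with an eigenvector of sum zero, and a lower bound for
the gaps of `G` and of all its token graphs, then `l` is the algebraic connectivity of them all. -/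
lemma algebraicConnectivity_tokenGraph_eq {G : SimpleGraph V} {l : ℝ}
    (hl : l ∈ lapEigenvaluesOnW G) (h1 : HasGap (adjWeight G) Finset.univ l)
    (h2 : HasTokenGap (adjWeight G) Finset.univ l) {k : ℕ} (hk : 1 ≤ k)
    (hk' : k < Fintype.card V) :
    algebraicConnectivity (tokenGraph G k) = algebraicConnectivity G ∧
      algebraicConnectivity G = l := by
  have e1 : algebraicConnectivity G = l :=
    IsLeast.csInf_eq ⟨hl, fun μ hμ => h1.le_of_mem hμ⟩
  have e2 : algebraicConnectivity (tokenGraph G k) = l :=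
    IsLeast.csInf_eq ⟨mem_lapEigenvaluesOnW_tokenGraph hk hk' hl, fun μ hμ => h2.le_of_mem hμ⟩
  exact ⟨e2.trans e1.symm, e1⟩

end

/-! ### The algebraic connectivity of complete and complete bipartite graphs -/

section
variable {V : Type*} [DecidableEq V] [Fintype V]

/-- If `p` and `q` are twins, then the vector `1` at `p` and `-1` at `q` is an eigenvector. -/
lemma mem_lapEigenvaluesOnW_of_twins {G : SimpleGraph V} {l : ℝ} {p q : V} (hpq : p ≠ q)
    (h : ∀ x, x ≠ p → x ≠ q → adjWeight G x p = adjWeight G x q)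
    (hp : ∑ y, adjWeight G p y + adjWeight G p q = l)
    (hq : ∑ y, adjWeight G q y + adjWeight G q p = l) : l ∈ lapEigenvaluesOnW G := by
  set v : V → ℝ := fun x => (if x = p then 1 else 0) - (if x = q then 1 else 0) with hv
  have hself : ∀ x, adjWeight G x x = 0 := fun x => by simp [adjWeight]
  refine mem_lapEigenvaluesOnW.mpr ⟨v, fun h0 => ?_, by simp [hv], fun x => ?_⟩
  · have := congrFun h0 p
    simp [hv, hpq] at this
  have h1 : ∑ y, adjWeight G x y * (v x - v y)
      = (∑ y, adjWeight G x y) * v x - (adjWeight G x p - adjWeight G x q) := by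
    simp only [mul_sub (adjWeight G x _), Finset.sum_sub_distrib, ← Finset.sum_mul]
    simp [hv, mul_sub]
  rw [h1]
  by_cases hxp : x = p
  · subst hxp
    simp [hv, hpq, hself, ← hp]
  · by_cases hxq : x = q
    · subst hxq
      simp [hv, hpq.symm, hself, ← hq]; ring
    · simp [hv, hxp, hxq, h x hxp hxq]

lemma algebraicConnectivity_of_complete {G : SimpleGraph V} (hG : ∀ a b, G.Adj a b ↔ a ≠ b)
    {k : ℕ} (hk : 1 ≤ k) (hk' : k < Fintype.card V) :
    algebraicConnectivity (tokenGraph G k) = algebraicConnectivity G ∧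
      algebraicConnectivity G = Fintype.card V := by
  have hw : adjWeight G = fun a b => if a ≠ b then 1 else 0 := by
    ext a b; simp [adjWeight, hG]
  obtain ⟨p, q, hpq⟩ := Fintype.exists_pair_of_one_lt_card (hk.trans_lt hk')
  have hdeg : ∀ p q, p ≠ q → ∑ y, adjWeight G p y + adjWeight G p q = Fintype.card V := by
    intro p q hpq
    have : ∀ y, adjWeight G p y = 1 - if p = y then 1 else 0 := fun y => by
      rw [hw]; by_cases h : p = y <;> simp [h]
    simp [this, hpq]
  refine algebraicConnectivity_tokenGraph_eq (mem_lapEigenvaluesOnW_of_twins hpq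
    (fun x hxp hxq => by simp [hw, hxp, hxq]) (hdeg p q hpq) (hdeg q p hpq.symm)) ?_ ?_ hk hk'
  · rw [hw]; exact hasGap_complete Finset.univ
  · rw [hw]; exact hasTokenGap_complete Finset.univ

/-- The classes of the complete bipartite graph are given by a colouring `χ`; the twins are two
vertices of the colour `c` of the larger class. -/
lemma algebraicConnectivity_of_bipartite {G : SimpleGraph V} (χ : V → Bool)
    (hG : ∀ a b, G.Adj a b ↔ χ a ≠ χ b) {l : ℕ} (c : Bool)
    (hl : (Finset.univ.filter fun x => χ x = !c).card = l)
    (hl' : l ≤ (Finset.univ.filter fun x => χ x = c).card)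
    (h2 : 1 < (Finset.univ.filter fun x => χ x = c).card)
    {k : ℕ} (hk : 1 ≤ k) (hk' : k < Fintype.card V) :
    algebraicConnectivity (tokenGraph G k) = algebraicConnectivity G ∧
      algebraicConnectivity G = l := by
  have hw : adjWeight G = fun a b => if χ a ≠ χ b then 1 else 0 := by
    ext a b; simp [adjWeight, hG]
  have hlc : ∀ c', l ≤ (Finset.univ.filter fun x => χ x = c').card := by
    intro c'
    rcases eq_or_ne c' c with rfl | h
    · exact hl'
    · rw [Bool.eq_not.mpr h, hl]
  obtain ⟨p, hp, q, hq, hpq⟩ := Finset.one_lt_card.mp h2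
  simp only [Finset.mem_filter, Finset.mem_univ, true_and] at hp hq
  have hdeg : ∀ p q, χ p = c → χ q = c → ∑ y, adjWeight G p y + adjWeight G p q = l := by
    intro p q hp hq
    simp only [hw, hp, hq, ne_eq, not_true_eq_false, if_false, add_zero, Finset.sum_boole]
    rw [← hl]
    congr 2
    ext y
    rw [Finset.mem_filter, Finset.mem_filter, Bool.eq_not, ne_comm]
  refine algebraicConnectivity_tokenGraph_eq (mem_lapEigenvaluesOnW_of_twins hpq
    (fun x _ _ => by simp [hw, hp, hq]) (hdeg p q hp hq) (hdeg q p hq hp)) ?_ ?_ hk hk'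
  · rw [hw]; exact hasGap_bipartite χ Finset.univ hlc
  · rw [hw]; exact hasTokenGap_bipartite χ Finset.univ hlc

end

/-! ### Path graphs -/

/-- The discrete Dirichlet inequality. The partial sums of the Dirichlet form are compared through
the positive ground state `j ↦ sin (j π / n)`: each step completes a square. -/
lemma dirichlet_sum_le {n : ℕ} (s : ℕ → ℝ) (h0 : s 0 = 0) (hn : s n = 0) :
    2 * (1 - Real.cos (Real.pi / n)) * ∑ j ∈ Finset.range n, s j ^ 2
      ≤ ∑ j ∈ Finset.range n, (s (j + 1) - s j) ^ 2 := by
  set θ := Real.pi / n with hθ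
  set p : ℕ → ℝ := fun j => Real.sin (j * θ) with hp
  have hpos : ∀ j, 0 < j → j < n → 0 < p j := by
    intro j hj hjn
    have hn0 : (0 : ℝ) < n := by exact_mod_cast (hj.trans hjn)
    have hθ0 : 0 < θ := div_pos Real.pi_pos hn0
    refine Real.sin_pos_of_pos_of_lt_pi (mul_pos (by exact_mod_cast hj) hθ0) ?_
    calc (j : ℝ) * θ < n * θ := mul_lt_mul_of_pos_right (by exact_mod_cast hjn) hθ0
      _ = Real.pi := by rw [hθ]; field_simp
  have hrec : ∀ j, p (j + 2) = 2 * Real.cos θ * p (j + 1) - p j := by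
    intro j
    simp only [hp]
    push_cast
    rw [show ((j : ℝ) + 2) * θ = (j + 1) * θ + θ by ring,
      show (j : ℝ) * θ = (j + 1) * θ - θ by ring, Real.sin_add, Real.sin_sub]
    ring
  have key : ∀ m, m + 1 < n →
      2 * (1 - Real.cos θ) * ∑ j ∈ Finset.range (m + 1), s j ^ 2
        + s (m + 1) ^ 2 * (1 - p m / p (m + 1))
      ≤ ∑ j ∈ Finset.range (m + 1), (s (j + 1) - s j) ^ 2 := by
    intro m
    induction m with
    | zero => intro _; simp [h0, hp]
    | succ m ih =>
      intro hm
      have ih := ih (by omega)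
      rw [Finset.sum_range_succ, Finset.sum_range_succ _ (m + 1)]
      have p1 := hpos (m + 1) (by omega) (by omega)
      have p2 := hpos (m + 2) (by omega) hm
      have e : p m / p (m + 1) = 2 * Real.cos θ - p (m + 2) / p (m + 1) := by
        rw [hrec m]; field_simp; ring
      rw [e] at ih
      have hsq : 0 ≤ (p (m + 2) * s (m + 1) - p (m + 1) * s (m + 2)) ^ 2
          / (p (m + 1) * p (m + 2)) := by positivity
      have hsq' : (p (m + 2) * s (m + 1) - p (m + 1) * s (m + 2)) ^ 2 / (p (m + 1) * p (m + 2))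
          = p (m + 2) / p (m + 1) * s (m + 1) ^ 2 - 2 * s (m + 1) * s (m + 2)
            + p (m + 1) / p (m + 2) * s (m + 2) ^ 2 := by
        field_simp; ring
      rw [hsq'] at hsq
      change _ + s (m + 2) ^ 2 * (1 - p (m + 1) / p (m + 2))
        ≤ _ + (s (m + 2) - s (m + 1)) ^ 2
      nlinarith
  rcases n with _ | _ | m
  · simp
  · simp [h0, hn]
  · have h := key m (by omega)
    have p1 := hpos (m + 1) (by omega) (by omega)
    -- The ground state vanishes at `n`, so that nothing is left over in the last step.
    have p2 : p (m + 2) = 0 := by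
      simp only [hp, hθ]
      rw [mul_div_cancel₀]
      · exact Real.sin_pi
      · exact Nat.cast_ne_zero.mpr (by omega)
    have e : p m / p (m + 1) = 2 * Real.cos θ := by
      rw [div_eq_iff p1.ne']; linarith [hrec m]
    rw [e] at h
    rw [Finset.sum_range_succ, Finset.sum_range_succ _ (m + 1)]
    change s (m + 2) = 0 at hn
    change _ ≤ _ + (s (m + 2) - s (m + 1)) ^ 2
    rw [hn]
    linarith

lemma sum_range_mul_sum_parts (u : ℕ → ℝ) (n : ℕ) :
    ∑ i ∈ Finset.range (n + 1), u i ^ 2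
      = u n * ∑ i ∈ Finset.range (n + 1), u i
        - ∑ i ∈ Finset.range n, (∑ j ∈ Finset.range (i + 1), u j) * (u (i + 1) - u i) := by
  induction n with
  | zero => simp; ring
  | succ n ih =>
    rw [Finset.sum_range_succ (fun i => u i ^ 2), ih, Finset.sum_range_succ u (n + 1),
      Finset.sum_range_succ (fun i => (∑ j ∈ Finset.range (i + 1), u j) * (u (i + 1) - u i)) n]
    ring

/-- The discrete Wirtinger inequality: the partial sums `s` of a zero-sum `u` satisfy Dirichlet
boundary conditions, and `∑ u ^ 2` is both the Dirichlet form of `s` and, by summation by parts,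
the pairing of `s` with the increments of `u`. -/
lemma wirtinger_sum_le {n : ℕ} (u : ℕ → ℝ) (hu : ∑ i ∈ Finset.range (n + 1), u i = 0) :
    2 * (1 - Real.cos (Real.pi / (n + 1 : ℕ))) * ∑ i ∈ Finset.range (n + 1), u i ^ 2
      ≤ ∑ i ∈ Finset.range n, (u (i + 1) - u i) ^ 2 := by
  set l := 2 * (1 - Real.cos (Real.pi / (n + 1 : ℕ))) with hl
  have hl0 : 0 ≤ l := by linarith [Real.cos_le_one (Real.pi / (n + 1 : ℕ))]
  have hD := dirichlet_sum_le (n := n + 1) (fun j => ∑ i ∈ Finset.range j, u i) (by simp) hu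
  have hinc : ∀ j, ∑ i ∈ Finset.range (j + 1), u i - ∑ i ∈ Finset.range j, u i = u j := fun j => by
    rw [Finset.sum_range_succ]; ring
  simp only [hinc] at hD
  rw [← hl, Finset.sum_range_succ'] at hD
  simp only [Finset.range_zero, Finset.sum_empty, ne_eq, OfNat.ofNat_ne_zero, not_false_eq_true,
    zero_pow, add_zero] at hD
  have hparts := sum_range_mul_sum_parts u n
  rw [hu, mul_zero, zero_sub] at hparts
  have hCS := Finset.sum_mul_sq_le_sq_mul_sq (Finset.range n)
    (fun i => ∑ j ∈ Finset.range (i + 1), u j) (fun i => u (i + 1) - u i)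
  rw [← neg_sq, ← hparts] at hCS
  set Q := ∑ i ∈ Finset.range (n + 1), u i ^ 2
  set D := ∑ i ∈ Finset.range n, (u (i + 1) - u i) ^ 2
  set P := ∑ i ∈ Finset.range n, (∑ j ∈ Finset.range (i + 1), u j) ^ 2
  have hD0 : 0 ≤ D := Finset.sum_nonneg fun _ _ => sq_nonneg _
  have hQ0 : 0 ≤ Q := Finset.sum_nonneg fun _ _ => sq_nonneg _
  rcases hQ0.eq_or_lt with h | h
  · rw [← h, mul_zero]; exact hD0
  · refine le_of_mul_le_mul_right ?_ h
    calc l * Q * Q = l * Q ^ 2 := by ring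
      _ ≤ l * (P * D) := mul_le_mul_of_nonneg_left hCS hl0
      _ = l * P * D := by ring
      _ ≤ Q * D := mul_le_mul_of_nonneg_right hD hD0
      _ = D * Q := mul_comm _ _

/-- The first `m` vertices of the path on `Fin n`. -/
def initialSegment (n m : ℕ) : Finset (Fin n) := Finset.univ.filter fun x => x.val < m

lemma mem_initialSegment {n m : ℕ} {x : Fin n} : x ∈ initialSegment n m ↔ x.val < m := by
  simp [initialSegment]

lemma sum_initialSegment {n m : ℕ} (hm : m ≤ n) (F : ℕ → ℝ) :
    ∑ x ∈ initialSegment n m, F x = ∑ i ∈ Finset.range m, F i :=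
  Finset.sum_bij (fun x _ => x.val) (fun _ hx => Finset.mem_range.mpr (mem_initialSegment.mp hx))
    (fun _ _ _ _ h => Fin.ext h)
    (fun i hi => ⟨⟨i, (Finset.mem_range.mp hi).trans_le hm⟩,
      mem_initialSegment.mpr (Finset.mem_range.mp hi), rfl⟩) (fun _ _ => rfl)

lemma adjWeight_pathGraph {n : ℕ} (x y : Fin n) :
    adjWeight (SimpleGraph.pathGraph n) x y
      = (if x.val + 1 = y.val then 1 else 0) + (if y.val + 1 = x.val then 1 else 0) := by
  simp only [adjWeight, SimpleGraph.pathGraph_adj]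
  split_ifs <;> first | omega | norm_num

lemma hasGap_path {n m : ℕ} (hm : m + 1 ≤ n) :
    HasGap (adjWeight (SimpleGraph.pathGraph n)) (initialSegment n (m + 1))
      (2 * (1 - Real.cos (Real.pi / (m + 1 : ℕ)))) := by
  intro v hv
  obtain ⟨u, rfl⟩ : ∃ u : ℕ → ℝ, v = fun x => u x.val :=
    ⟨fun i => if h : i < n then v ⟨i, h⟩ else 0, by ext x; simp⟩
  have e1 : ∑ i ∈ Finset.range (m + 1), ∑ j ∈ Finset.range (m + 1),
      (if i + 1 = j then (u i - u j) ^ 2 else 0)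
        = ∑ i ∈ Finset.range m, (u (i + 1) - u i) ^ 2 := by
    simp only [Finset.sum_ite_eq, Finset.mem_range, add_lt_add_iff_right]
    rw [Finset.sum_range_succ, if_neg (lt_irrefl m), add_zero]
    exact Finset.sum_congr rfl fun i hi => by rw [if_pos (Finset.mem_range.mp hi)]; ring
  have hE : ∑ a ∈ initialSegment n (m + 1), ∑ b ∈ initialSegment n (m + 1),
      adjWeight (SimpleGraph.pathGraph n) a b * (u a - u b) ^ 2
        = 2 * ∑ i ∈ Finset.range m, (u (i + 1) - u i) ^ 2 := by
    simp only [adjWeight_pathGraph]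
    have h1 : ∀ a : Fin n, ∑ b ∈ initialSegment n (m + 1),
        ((if a.val + 1 = b.val then 1 else 0) + (if b.val + 1 = a.val then 1 else 0))
          * (u a - u b) ^ 2
        = ∑ j ∈ Finset.range (m + 1),
          ((if a.val + 1 = j then 1 else 0) + (if j + 1 = a.val then 1 else 0))
            * (u a - u j) ^ 2 := fun a =>
      sum_initialSegment hm fun j =>
        ((if a.val + 1 = j then 1 else 0) + (if j + 1 = a.val then 1 else 0)) * (u a - u j) ^ 2
    simp only [h1]
    rw [sum_initialSegment hm fun i => ∑ j ∈ Finset.range (m + 1),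
          ((if i + 1 = j then 1 else 0) + (if j + 1 = i then 1 else 0)) * (u i - u j) ^ 2]
    simp only [add_mul, ite_mul, one_mul, zero_mul, Finset.sum_add_distrib]
    rw [e1, Finset.sum_comm (f := fun i j => if j + 1 = i then (u i - u j) ^ 2 else 0), two_mul,
      ← e1]
    congr 1
    refine Finset.sum_congr rfl fun i _ => Finset.sum_congr rfl fun j _ => ?_
    rw [← neg_sq, neg_sub]
  rw [sum_initialSegment hm u] at hv
  rw [hE, sum_initialSegment hm fun i => u i ^ 2]
  linarith [wirtinger_sum_le u hv]

/-- Deleting an end vertex of a path yields a shorter path, of larger gap. -/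
lemma hasTokenGap_path {n m : ℕ} (hm : m + 1 ≤ n) :
    HasTokenGap (adjWeight (SimpleGraph.pathGraph n)) (initialSegment n (m + 1))
      (2 * (1 - Real.cos (Real.pi / (m + 1 : ℕ)))) := by
  induction m with
  | zero =>
    refine .of_card_le_one (Finset.card_le_one.mpr fun a ha b hb => ?_) _
    rw [mem_initialSegment] at ha hb
    exact Fin.ext (by omega)
  | succ m ih =>
    let x : Fin n := ⟨m + 1, hm⟩
    have hx : x ∈ initialSegment n (m + 1 + 1) := mem_initialSegment.mpr (Nat.lt_succ_self _)
    have hdel : (initialSegment n (m + 1 + 1)).erase x = initialSegment n (m + 1) := by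
      ext y
      rw [Finset.mem_erase, mem_initialSegment, mem_initialSegment, ne_eq, Fin.ext_iff]
      change ¬ y.val = m + 1 ∧ _ ↔ _
      omega
    refine (hasGap_path hm).hasTokenGap_of_erase (adjWeight_nonneg _) (X := {x})
      (Finset.singleton_subset_iff.mpr hx) (d := 1)
      (m := 2 * (1 - Real.cos (Real.pi / (m + 1 : ℕ)))) ?_ one_pos
      (fun a _ b _ _ _ => (Finset.card_filter_le _ _).trans (Finset.card_singleton x).le) ?_
    · intro y hy
      rw [Finset.mem_singleton.mp hy, hdel]
      exact ih (by omega)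
    · have h1 : (1 : ℝ) ≤ (m + 1 : ℕ) := by exact_mod_cast Nat.succ_pos m
      have := Real.cos_le_cos_of_nonneg_of_le_pi (x := Real.pi / (m + 1 + 1 : ℕ))
        (y := Real.pi / (m + 1 : ℕ)) (by positivity) (div_le_self Real.pi_pos.le h1)
        (div_le_div_of_nonneg_left Real.pi_pos.le (by positivity)
          (by exact_mod_cast Nat.le_succ _))
      rw [Finset.card_singleton, Nat.cast_one, one_mul, one_mul]
      linarith

/-- The eigenvector is `i ↦ cos ((2 i + 1) π / (2 n))`. -/
lemma mem_lapEigenvaluesOnW_path {n : ℕ} (hn : 2 ≤ n) :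
    2 * (1 - Real.cos (Real.pi / n)) ∈ lapEigenvaluesOnW (SimpleGraph.pathGraph n) := by
  have hn0 : (0 : ℝ) < n := by exact_mod_cast (by omega : 0 < n)
  set θ := Real.pi / (2 * n) with hθ
  have hθ2 : Real.pi / n = 2 * θ := by rw [hθ]; field_simp
  have hnθ : 2 * n * θ = Real.pi := by rw [hθ]; field_simp
  have hθ0 : 0 < θ := div_pos Real.pi_pos (by positivity)
  have hθπ : 2 * θ ≤ Real.pi / 2 := by
    have : (2 : ℝ) ≤ n := by exact_mod_cast hn
    nlinarith
  set u : ℕ → ℝ := fun i => Real.cos ((2 * i + 1) * θ) with hu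
  have hrec : ∀ i, u (i + 2) + u i = 2 * Real.cos (2 * θ) * u (i + 1) := by
    intro i
    simp only [hu]
    push_cast
    rw [show (2 * ((i : ℝ) + 2) + 1) * θ = (2 * (i + 1) + 1) * θ + 2 * θ by ring,
      show (2 * (i : ℝ) + 1) * θ = (2 * (i + 1) + 1) * θ - 2 * θ by ring,
      Real.cos_add, Real.cos_sub]
    ring
  have hfirst : u 1 + u 0 = 2 * Real.cos (2 * θ) * u 0 := by
    simp only [hu]
    push_cast
    rw [show (2 * (1 : ℝ) + 1) * θ = 2 * θ + θ by ring, show (2 * (0 : ℝ) + 1) * θ = θ by ring,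
      Real.cos_add]
    have := Real.cos_sub (2 * θ) θ
    rw [show 2 * θ - θ = θ by ring] at this
    linarith
  have hlast : u n = u (n - 1) := by
    simp only [hu]
    rw [Nat.cast_sub (by omega)]
    push_cast
    rw [show (2 * (n : ℝ) + 1) * θ = θ + 2 * n * θ by ring,
      show (2 * ((n : ℝ) - 1) + 1) * θ = 2 * n * θ - θ by ring, hnθ, Real.cos_add_pi,
      Real.cos_pi_sub]
  refine mem_lapEigenvaluesOnW.mpr ⟨fun x => u x, fun h0 => ?_, ?_, fun x => ?_⟩
  · have h1 := congrFun h0 ⟨0, by omega⟩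
    have h2 : 0 < Real.cos θ := Real.cos_pos_of_mem_Ioo ⟨by linarith, by linarith⟩
    simp [hu] at h1
    exact h2.ne' h1
  · -- Multiplied by `2 * sin θ`, the sum telescopes.
    have hs : 0 < Real.sin θ :=
      Real.sin_pos_of_pos_of_lt_pi hθ0 (by linarith [Real.pi_pos])
    rw [Fin.sum_univ_eq_sum_range u n]
    have h1 : ∀ i, 2 * Real.sin θ * u i
        = Real.sin (2 * (i + 1 : ℕ) * θ) - Real.sin (2 * (i : ℕ) * θ) := by
      intro i
      simp only [hu]
      push_cast
      rw [show 2 * ((i : ℝ) + 1) * θ = (2 * i + 1) * θ + θ by ring,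
        show 2 * (i : ℝ) * θ = (2 * i + 1) * θ - θ by ring, Real.sin_add, Real.sin_sub]
      ring
    have h2 : 2 * Real.sin θ * ∑ i ∈ Finset.range n, u i = 0 := by
      rw [Finset.mul_sum, Finset.sum_congr rfl fun i _ => h1 i,
        Finset.sum_range_sub (fun i : ℕ => Real.sin (2 * (i : ℕ) * θ)), hnθ]
      simp
    exact (mul_eq_zero.mp h2).resolve_left (by positivity)
  · simp only [adjWeight_pathGraph]
    rw [Fin.sum_univ_eq_sum_range (fun j =>
      ((if x.val + 1 = j then 1 else 0) + (if j + 1 = x.val then 1 else 0)) * (u x - u j)) n]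
    obtain ⟨x, hx⟩ := x
    simp only [add_mul, ite_mul, one_mul, zero_mul, Finset.sum_add_distrib, Finset.sum_ite_eq,
      Finset.mem_range]
    rw [hθ2]
    have hup : (if x + 1 < n then u x - u (x + 1) else 0) = u x - u (x + 1) := by
      split_ifs with h
      · rfl
      · rw [show x = n - 1 by omega, show n - 1 + 1 = n by omega, hlast, sub_self]
    rw [hup]
    rcases x with _ | x
    · simp only [Nat.succ_ne_zero, if_false, Finset.sum_const_zero]
      linarith
    · simp only [add_left_inj, Finset.sum_ite_eq', Finset.mem_range]
      rw [if_pos (by omega)]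
      linarith [hrec x]

lemma algebraicConnectivity_path {n k : ℕ} (hk : 1 ≤ k) (hk' : k < n) :
    algebraicConnectivity (tokenGraph (SimpleGraph.pathGraph n) k)
        = algebraicConnectivity (SimpleGraph.pathGraph n) ∧
      algebraicConnectivity (SimpleGraph.pathGraph n) = 2 * (1 - Real.cos (Real.pi / n)) := by
  obtain ⟨m, rfl⟩ : ∃ m, n = m + 1 := ⟨n - 1, by omega⟩
  have hS : initialSegment (m + 1) (m + 1) = Finset.univ := by
    ext x; simp only [mem_initialSegment, x.2, Finset.mem_univ]
  have h1 := hasGap_path (le_refl (m + 1))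
  have h2 := hasTokenGap_path (le_refl (m + 1))
  rw [hS] at h1 h2
  exact algebraicConnectivity_tokenGraph_eq (mem_lapEigenvaluesOnW_path (by omega)) h1 h2 hk
    (by simpa using hk')

/-! ### The four classes of graphs -/

theorem mainTheorem8 :
    -- complete graphs
    (∀ n k : ℕ, 1 ≤ k → k < n →
      algebraicConnectivity (tokenGraph (SimpleGraph.completeGraph (Fin n)) k)
          = algebraicConnectivity (SimpleGraph.completeGraph (Fin n)) ∧
        algebraicConnectivity (SimpleGraph.completeGraph (Fin n)) = (n : ℝ)) ∧
    -- stars (with any centre `c`)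
    (∀ (n k : ℕ) (c : Fin n), 1 ≤ k → k < n →
      algebraicConnectivity (tokenGraph (SimpleGraph.starGraph c) k)
          = algebraicConnectivity (SimpleGraph.starGraph c) ∧
        (n ≠ 2 → algebraicConnectivity (SimpleGraph.starGraph c) = 1)) ∧
    -- paths
    (∀ n k : ℕ, 1 ≤ k → k < n →
      algebraicConnectivity (tokenGraph (SimpleGraph.pathGraph n) k)
          = algebraicConnectivity (SimpleGraph.pathGraph n) ∧
        algebraicConnectivity (SimpleGraph.pathGraph n)
          = 2 * (1 - Real.cos (Real.pi / (n : ℝ)))) ∧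
    -- complete bipartite graphs
    (∀ n₁ n₂ k : ℕ, n₁ ≤ n₂ → 1 ≤ k → k < n₁ + n₂ →
      algebraicConnectivity (tokenGraph (completeBipartiteGraph (Fin n₁) (Fin n₂)) k)
          = algebraicConnectivity (completeBipartiteGraph (Fin n₁) (Fin n₂)) ∧
        (¬ (n₁ = 1 ∧ n₂ = 1) →
          algebraicConnectivity (completeBipartiteGraph (Fin n₁) (Fin n₂)) = (n₁ : ℝ))) := by
  refine ⟨fun n k hk hkn => ?_, fun n k c hk hkn => ?_, fun n k hk hkn => ?_,
    fun n₁ n₂ k h12 hk hkn => ?_⟩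
  · simpa using algebraicConnectivity_of_complete (G := SimpleGraph.completeGraph (Fin n))
      (fun a b => by simp [SimpleGraph.completeGraph]) hk (by simpa using hkn)
  · by_cases hn : n = 2
    · subst hn
      have hG : ∀ a b, (SimpleGraph.starGraph c).Adj a b ↔ a ≠ b := by
        intro a b
        rw [SimpleGraph.starGraph_adj]
        omega
      exact ⟨(algebraicConnectivity_of_complete hG hk (by simpa using hkn)).1,
        fun h => absurd rfl h⟩
    · have h1 : (Finset.univ.filter fun x : Fin n => decide (x = c) = false).card = n - 1 := by
        rw [show (Finset.univ.filter fun x : Fin n => decide (x = c) = false)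
          = Finset.univ.erase c by ext; simp, Finset.card_erase_of_mem (Finset.mem_univ c),
          Finset.card_univ, Fintype.card_fin]
      have := algebraicConnectivity_of_bipartite (G := SimpleGraph.starGraph c) (l := 1)
        (fun x => decide (x = c))
        (fun a b => by
          rw [SimpleGraph.starGraph_adj]
          grind)
        false (by simp [Finset.filter_eq']) (by rw [h1]; omega) (by rw [h1]; omega) hk
        (by simpa using hkn)
      exact ⟨this.1, fun _ => by simpa using this.2⟩
  · exact algebraicConnectivity_path hk hkn
  · by_cases hn : n₁ = 1 ∧ n₂ = 1
    · obtain ⟨rfl, rfl⟩ := hn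
      have hG : ∀ a b, (completeBipartiteGraph (Fin 1) (Fin 1)).Adj a b ↔ a ≠ b := by
        rintro (a | a) (b | b) <;> simp [Subsingleton.elim a b]
      exact ⟨(algebraicConnectivity_of_complete hG hk (by simpa using hkn)).1,
        fun h => absurd ⟨rfl, rfl⟩ h⟩
    · have hcl : (Finset.univ.filter fun x : Fin n₁ ⊕ Fin n₂ => x.isLeft = true).card = n₁ := by
        rw [Finset.card_filter, Fintype.sum_sum_type]; simp
      have hcr : (Finset.univ.filter fun x : Fin n₁ ⊕ Fin n₂ => x.isLeft = false).card = n₂ := by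
        rw [Finset.card_filter, Fintype.sum_sum_type]; simp
      have := algebraicConnectivity_of_bipartite
        (G := completeBipartiteGraph (Fin n₁) (Fin n₂)) (l := n₁) Sum.isLeft
        (by rintro (a | a) (b | b) <;> simp) false hcl (by rw [hcr]; exact h12)
        (by rw [hcr]; omega) hk (by simpa using hkn)
      exact ⟨this.1, fun _ => this.2⟩
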